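/- Let $X$ be a nonzero real Banach space with topological dual $X^*$, and let $T:X\rightrightarrows X^*$ be a monotone (multivalued) operator with graph $G(T)=\{(x,x^*):x^*\in T(x)\}$ and domain $D_T=\{x:T(x)\neq\emptyset\}$. An operator is maximal monotone if it is monotone and its graph is not strictly contained in the graph of a monotone operator. Sums of operators are pointwise Minkowski sums, $I_C$ is the indicator function of $C\subset X$ ($0$ on $C$, $+\infty$ off $C$), and $\partial I_C$ is its subdifferential. A maximal monotone operator $S$ is of type (FPV) if for every open convex $U\subset X$ with $U\cap D_S\ne\emptyset$, every $x\in U$ and every $x^*\in X^*$: if $\langle x^*-y^*,x-y\rangle\ge 0$ for all $(y,y^*)\in G(S)$ with $y\in U$, then $(x,x^*)\in G(S)$. It is regular if for all $(x,x^*)\in X\times X^*$ $$L(x,x^*,S)=d(x^*,S(x)),\qquad L(x,x^*,S):=\sup\left(\{0\}\cup\left\{\frac{\langle y^*-x^*,x-y\rangle}{\|x-y\|}:(y,y^*)\in G(S),\ y\neq x\right\}\right)\in[0,\infty],$$ where $d(x^*,\emptyset)=\infty$. Let $\mathcal C_0(T)$ be the family of closed convex $C\subset X$ with $D_T\cap\operatorname{int}C\neq\emptyset$,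 and let $\mathcal C_1(T)$ be the family of closed convex $C\subset X$ such that $\bigcup_{\lambda>0}\lambda(\operatorname{co}D_T-C)$ is a closed linear subspace of $X$. For $i\in\{0,1\}$, $T$ is called $\mathcal C_i$-maximal (respectively $\mathcal C_i$-regular) if $T+\partial I_C$ is maximal monotone (respectively regular maximal monotone) for every $C\in\mathcal C_i(T)$. **Theorem.** Let $i\in\{0,1\}$ and let $T$ be $\mathcal C_i$-maximal. Then for every $C\in\mathcal C_i(T)$ the operator $T+\partial I_C$ is of type (FPV) and is regular. Consequently, $T$ is $\mathcal C_i$-regular. -/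

import Mathlib

open scoped Pointwise

/-- A multivalued operator from a real normed space `X` to its topological dual. The sum of two
operators is the pointwise Minkowski sum `(T + S) x = T x + S x`, so that its domain is the
intersection of the two domains. -/
abbrev MultiOp (X : Type*) [NormedAddCommGroup X] [NormedSpace ℝ X] : Type _ :=
  X → Set (StrongDual ℝ X)

namespace MultiOp

variable {X : Type*} [NormedAddCommGroup X] [NormedSpace ℝ X]

/-- The graph of a multivalued operator. -/
def graph (T : MultiOp X) : Set (X × StrongDual ℝ X) := {p | p.2 ∈ T p.1}

/-- The domain of a multivalued operator. -/
def dom (T : MultiOp X) : Set X := {x | (T x).Nonempty}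

/-- Monotone operators. -/
def IsMonotone (T : MultiOp X) : Prop :=
  ∀ p ∈ graph T, ∀ q ∈ graph T, 0 ≤ (p.2 - q.2) (p.1 - q.1)

/-- Maximal monotone operators: no monotone operator has a strictly larger graph. -/
def IsMaximalMonotone (T : MultiOp X) : Prop :=
  IsMonotone T ∧ ∀ S : MultiOp X, IsMonotone S → ¬ graph T ⊂ graph S

/-- Maximal monotone operators of type (FPV): for every open convex set `U` meeting the domain,
a pair `(x, x')` with `x ∈ U` that is monotonically related to the part of the graph lying over
`U` belongs to the graph. -/
def IsTypeFPV (T : MultiOp X) : Prop :=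
  IsMaximalMonotone T ∧
    ∀ U : Set X, IsOpen U → Convex ℝ U → (U ∩ dom T).Nonempty →
      ∀ x ∈ U, ∀ x' : StrongDual ℝ X,
        (∀ y ∈ U, ∀ y' ∈ T y, 0 ≤ (x' - y') (x - y)) → x' ∈ T x

/-- The number `L(x, x', T)`, the supremum of `⟨y' - x', x - y⟩ / ‖x - y‖` over all `(y, y')` in the
graph of `T` with `y ≠ x`. The supremum is taken in `[0, ∞]`: it is `0` when there is no such pair
or when all the quotients are negative. -/
noncomputable def regularityGap (x : X) (x' : StrongDual ℝ X) (T : MultiOp X) : ENNReal :=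
  ⨆ p ∈ {p : X × StrongDual ℝ X | p ∈ graph T ∧ p.1 ≠ x},
    ENNReal.ofReal ((p.2 - x') (x - p.1) / ‖x - p.1‖)

/-- Regular maximal monotone operators: `L(x, x', T) = d(x', T x)` for all `(x, x')`, where the
distance to the empty set is `∞`. -/
def IsRegular (T : MultiOp X) : Prop :=
  IsMaximalMonotone T ∧
    ∀ (x : X) (x' : StrongDual ℝ X), regularityGap x x' T = Metric.infEDist x' (T x)

/-- The subdifferential of an extended real valued function; it is empty at the points where the
function is not finite. -/
def subdifferential (f : X → EReal) : MultiOp X := fun x =>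
  {x' | f x ≠ ⊤ ∧ f x ≠ ⊥ ∧ ∀ y, f x + ((x' (y - x) : ℝ) : EReal) ≤ f y}

open Classical in
/-- The indicator function `I_C` of convex analysis: `0` on `C` and `+∞` off `C`. -/
noncomputable def indicatorFun (C : Set X) : X → EReal := fun x => if x ∈ C then 0 else ⊤

/-- The class `𝒞₀(T)` of closed convex sets whose interior meets the domain of `T`. -/
def class0 (T : MultiOp X) : Set (Set X) :=
  {C | IsClosed C ∧ Convex ℝ C ∧ (dom T ∩ interior C).Nonempty}

/-- The class `𝒞₁(T)` of closed convex sets `C` such that the cone generated by `co (dom T) - C`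
is a closed linear subspace. -/
def class1 (T : MultiOp X) : Set (Set X) :=
  {C | IsClosed C ∧ Convex ℝ C ∧ ∃ Y : Submodule ℝ X, IsClosed (Y : Set X) ∧
    (⋃ r ∈ Set.Ioi (0 : ℝ), r • (convexHull ℝ (dom T) - C)) = (Y : Set X)}

/-- The class `𝒞ᵢ(T)`, `i ∈ {0, 1}`. -/
def constraintClass (T : MultiOp X) : Fin 2 → Set (Set X) := ![class0 T, class1 T]

/-- `𝒞ᵢ`-maximal operators. -/
def IsClassMaximal (i : Fin 2) (T : MultiOp X) : Prop :=
  ∀ C ∈ constraintClass T i, IsMaximalMonotone (T + subdifferential (indicatorFun C))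

/-- `𝒞ᵢ`-regular operators. -/
def IsClassRegular (i : Fin 2) (T : MultiOp X) : Prop :=
  ∀ C ∈ constraintClass T i, IsRegular (T + subdifferential (indicatorFun C))

end MultiOp

/-!
The proof isolates one property of the sum `S = T + ∂I_C`: it is itself `𝒞₀`-maximal, that is,
`S + ∂I_D` is maximal monotone for every closed convex `D` whose interior meets `dom S`
(`IsClassMaximal.add_normalCone`). Indeed `S + ∂I_D = T + ∂I_{C ∩ D}` by the sum rule for normal
cones (`normalCone_inter`), and `C ∩ D` lies in the same class `𝒞ᵢ(T)` as `C`. For `i = 1` this is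
seen by shrinking differences `a - c` towards a point of `dom T ∩ C ∩ int D`; for `i = 0` it uses
that the closure of `dom T` is convex.

All the rest is about a maximal monotone, `𝒞₀`-maximal operator `S`. The basic tool is localization
(`IsClassMaximal.mem_add_normalCone`): a pair `(x, x')` with `x ∈ D` that is monotonically related
to the graph of `S` over `D` belongs to the graph of `S + ∂I_D`.

* If `D` is a closed tube inside `U` around a segment joining `x` to a point of the domain, then `x`
  is interior to `D` and the normal cone vanishes there: this is type (FPV).
* Type (FPV) forces the closure of `dom S` to be convex (`IsTypeFPV.convex_closure_dom`): a point `w`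
  between two points of the domain but off its closure would be monotonically related, with a steep
  enough functional, to the graph over a thin tube ending at `w`.
* For regularity, let `M = L(x, x', S)` be finite and let `D` be a Bishop–Phelps cone
  `{y | M‖y - x‖ ≤ f (y - x)}`. Then `(x, x' - f)` is monotonically related to `S` over `D`, which
  produces `s ∈ S x` with `s v ≥ x' v - f v` for every direction `v` of the cone. If `S x` missed
  the closed ball of radius `M` about `x'`, a direction `v` would separate the two sets by weak-*
  compactness of the ball. A cone around `v` would contradict this, unless its interior misses
  `dom S`; in that case a functional separating the interior from the convex set `closure (dom S)` is normal to the
  domain at `x`, and adding its multiples to an element of `S x` contradicts the separation.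
-/

namespace MultiOp

variable {X : Type*} [NormedAddCommGroup X] [NormedSpace ℝ X]

/-! ### Maximal monotone operators -/

theorem IsMaximalMonotone.mem {S : MultiOp X} (hS : IsMaximalMonotone S) {x : X}
    {x' : StrongDual ℝ X} (h : ∀ y, ∀ y' ∈ S y, 0 ≤ (x' - y') (x - y)) : x' ∈ S x := by
  by_contra hx
  refine hS.2 (fun y => S y ∪ {y' | y = x ∧ y' = x'}) ?_ ⟨?_, ?_⟩
  · rintro ⟨p, p'⟩ hp ⟨q, q'⟩ hq
    rcases hp with hp | ⟨rfl, rfl⟩ <;> rcases hq with hq | ⟨rfl, rfl⟩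
    · exact hS.1 (p, p') hp (q, q') hq
    · have := h p p' hp
      simp only [sub_apply, map_sub] at this ⊢
      linarith
    · exact h q q' hq
    · simp
  · exact fun p hp => Or.inl hp
  · exact fun hsub => hx (hsub (show (x, x') ∈ graph _ from Or.inr ⟨rfl, rfl⟩))

theorem IsMaximalMonotone.dom_nonempty {S : MultiOp X} (hS : IsMaximalMonotone S) :
    (dom S).Nonempty := by
  by_contra hne
  have hempty : ∀ y, ∀ y' ∈ S y, False := fun y y' hy => hne ⟨y, y', hy⟩
  exact hempty 0 0 (hS.mem fun y y' hy => (hempty y y' hy).elim)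

theorem IsMaximalMonotone.mem_iff {S : MultiOp X} (hS : IsMaximalMonotone S) {x : X}
    {x' : StrongDual ℝ X} : x' ∈ S x ↔ ∀ y, ∀ y' ∈ S y, y' (x - y) ≤ x' (x - y) := by
  refine ⟨fun hx y y' hy => ?_, fun h => hS.mem fun y y' hy => ?_⟩
  · have := hS.1 (x, x') hx (y, y') hy
    simpa using this
  · simpa using h y y' hy

theorem IsMaximalMonotone.convex_apply {S : MultiOp X} (hS : IsMaximalMonotone S) (x : X) :
    Convex ℝ (S x) := by
  intro p hp q hq a b ha hb hab
  rw [hS.mem_iff] at hp hq ⊢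
  intro y y' hy
  have h1 := mul_le_mul_of_nonneg_left (hp y y' hy) ha
  have h2 := mul_le_mul_of_nonneg_left (hq y y' hy) hb
  have h3 : y' (x - y) = a * y' (x - y) + b * y' (x - y) := by rw [← add_mul, hab, one_mul]
  rw [h3]
  simpa using add_le_add h1 h2

theorem IsMaximalMonotone.isClosed_weakDual {S : MultiOp X} (hS : IsMaximalMonotone S) (x : X) :
    IsClosed (WeakDual.toStrongDual ⁻¹' S x : Set (WeakDual ℝ X)) := by
  have : (WeakDual.toStrongDual ⁻¹' S x : Set (WeakDual ℝ X)) =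
      ⋂ (y) (y' ∈ S y), {p : WeakDual ℝ X | y' (x - y) ≤ p (x - y)} := by
    ext p
    rw [Set.mem_preimage, hS.mem_iff]
    simp
  rw [this]
  exact isClosed_iInter fun y => isClosed_iInter fun y' => isClosed_iInter fun _ =>
    isClosed_le continuous_const (WeakDual.eval_continuous _)

/-! ### Normal cones -/

/-- The normal cone operator of `C`, encoded as the subdifferential of the indicator function. -/
noncomputable abbrev normalCone (C : Set X) : MultiOp X := subdifferential (indicatorFun C)

theorem mem_normalCone {C : Set X} {x : X} {x' : StrongDual ℝ X} :
    x' ∈ normalCone C x ↔ x ∈ C ∧ ∀ y ∈ C, x' (y - x) ≤ 0 := by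
  by_cases hx : x ∈ C
  · simp only [normalCone, subdifferential, indicatorFun, hx, Set.mem_ofPred_eq, if_true, true_and,
      zero_add]
    refine ⟨fun h y hy => ?_, fun h => ⟨by simp, by simp, fun y => ?_⟩⟩
    · have := h.2.2 y
      rw [if_pos hy] at this
      exact_mod_cast this
    · split_ifs with hy
      · exact_mod_cast h y hy
      · exact le_top
  · simp [normalCone, subdifferential, indicatorFun, hx]

theorem exists_pos_add_smul_mem {D : Set X} {x : X} (hx : x ∈ interior D) (u : X) :
    ∃ t : ℝ, 0 < t ∧ t < 1 ∧ x + t • u ∈ interior D := by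
  have hc : Filter.Tendsto (fun t : ℝ => x + t • u) (nhdsWithin 0 (Set.Ioi 0)) (nhds x) := by
    have : Continuous fun t : ℝ => x + t • u := by fun_prop
    simpa using (this.tendsto 0).mono_left nhdsWithin_le_nhds
  have h1 := hc.eventually (isOpen_interior.mem_nhds hx)
  have h2 : ∀ᶠ t : ℝ in nhdsWithin 0 (Set.Ioi 0), t ∈ Set.Ioo (0 : ℝ) 1 :=
    Ioo_mem_nhdsGT one_pos
  obtain ⟨t, ht1, ht2⟩ := (h1.and h2).exists
  exact ⟨t, ht2.1, ht2.2, ht1⟩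

theorem eq_zero_of_mem_normalCone {D : Set X} {x : X} (hx : x ∈ interior D) {n : StrongDual ℝ X}
    (hn : n ∈ normalCone D x) : n = 0 := by
  have key : ∀ u, n u ≤ 0 := fun u => by
    obtain ⟨t, ht, -, hu⟩ := exists_pos_add_smul_mem hx u
    have := (mem_normalCone.1 hn).2 _ (interior_subset hu)
    simp only [add_sub_cancel_left, map_smul, smul_eq_mul] at this
    exact nonpos_of_mul_nonpos_right this ht
  ext u
  have h := key (-u)
  rw [map_neg] at h
  exact le_antisymm (key u) (by simpa using h)

theorem normalCone_univ : normalCone (Set.univ : Set X) = 0 := by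
  funext x
  ext n
  refine ⟨fun hn => eq_zero_of_mem_normalCone (by simp) hn, fun hn => ?_⟩
  obtain rfl : n = 0 := hn
  exact mem_normalCone.2 ⟨trivial, fun _ _ => by simp⟩

/-- The sum rule for normal cones. A functional `n` normal to `C ∩ D` at `y` is split by separating,
in `X × ℝ`, the strict hypograph of `n (· - y)` over `int D` from `C × [0, ∞)`. -/
theorem normalCone_inter {C D : Set X} (hC : Convex ℝ C) (hD : Convex ℝ D)
    (hCD : (C ∩ interior D).Nonempty) :
    normalCone (C ∩ D) = normalCone C + normalCone D := by
  funext y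
  ext n
  rw [Pi.add_apply, Set.mem_add]
  constructor
  · intro hn
    obtain ⟨⟨hyC, hyD⟩, hn⟩ := mem_normalCone.1 hn
    obtain ⟨z, hzC, hzD⟩ := hCD
    have hA : Convex ℝ {p : X × ℝ | p.1 ∈ interior D ∧ p.2 < n (p.1 - y)} := by
      rintro ⟨p, r⟩ ⟨hp, hr⟩ ⟨q, s⟩ ⟨hq, hs⟩ a b ha hb hab
      refine ⟨hD.interior hp hq ha hb hab, ?_⟩
      simp only [map_sub, map_add, map_smul, smul_eq_mul, Prod.fst_add, Prod.snd_add, Prod.smul_fst,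
        Prod.smul_snd] at hr hs ⊢
      have : n y = a * n y + b * n y := by rw [← add_mul, hab, one_mul]
      rcases ha.eq_or_lt with rfl | ha
      · obtain rfl : b = 1 := by linarith
        linarith
      · nlinarith [mul_lt_mul_of_pos_left hr ha, mul_le_mul_of_nonneg_left hs.le hb]
    have hAo : IsOpen {p : X × ℝ | p.1 ∈ interior D ∧ p.2 < n (p.1 - y)} :=
      (isOpen_interior.preimage continuous_fst).inter (isOpen_lt continuous_snd
        (n.continuous.comp (continuous_fst.sub continuous_const)))
    have hB : Convex ℝ (C ×ˢ Set.Ici (0 : ℝ)) := hC.prod (convex_Ici 0)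
    have hdisj : Disjoint {p : X × ℝ | p.1 ∈ interior D ∧ p.2 < n (p.1 - y)}
        (C ×ˢ Set.Ici (0 : ℝ)) := by
      rw [Set.disjoint_left]
      rintro ⟨p, r⟩ ⟨hp, hr⟩ ⟨hpC, hr0⟩
      have := hn p ⟨hpC, interior_subset hp⟩
      simp only [Set.mem_Ici] at hr0 hr
      linarith
    obtain ⟨F, u, hFA, hFB⟩ := geometric_hahn_banach_open hA hAo hB hdisj
    set g : StrongDual ℝ X := F.comp (ContinuousLinearMap.inl ℝ X ℝ) with hg
    set α : ℝ := F (0, 1) with hα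
    have hF : ∀ p r, F (p, r) = g p + r * α := fun p r => by
      have : (p, r) = (p, (0 : ℝ)) + r • ((0 : X), (1 : ℝ)) := by simp
      rw [this, map_add, map_smul, smul_eq_mul]
      rfl
    have hB' : ∀ c ∈ C, ∀ r, 0 ≤ r → u ≤ g c + r * α := fun c hc r hr => by
      rw [← hF]
      exact hFB (c, r) ⟨hc, hr⟩
    have hA' : ∀ d ∈ interior D, ∀ r, r < n (d - y) → g d + r * α < u := fun d hd r hr => by
      rw [← hF]
      exact hFA (d, r) ⟨hd, hr⟩
    -- The separating hyperplane is not vertical, because of the common point `z`.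
    have hα0 : 0 < α := by
      have h1 := hA' z hzD (n (z - y) - 1) (by linarith)
      have h2 := hB' z hzC 0 le_rfl
      have h3 := hn z ⟨hzC, interior_subset hzD⟩
      by_contra hneg
      nlinarith
    have hAi : ∀ d ∈ interior D, g d + n (d - y) * α ≤ u := fun d hd => by
      refine le_of_forall_pos_lt_add fun ε hε => ?_
      have := hA' d hd (n (d - y) - ε / α) (by have := div_pos hε hα0; linarith)
      rw [sub_mul, div_mul_cancel₀ _ hα0.ne'] at this
      linarith
    have hAc : ∀ d ∈ D, g d + n (d - y) * α ≤ u := fun d hd => by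
      have hcl : IsClosed {d : X | g d + n (d - y) * α ≤ u} :=
        isClosed_le (by fun_prop) continuous_const
      refine closure_minimal (s := interior D) hAi hcl ?_
      rw [hD.closure_interior_eq_closure_of_nonempty_interior ⟨z, hzD⟩]
      exact subset_closure hd
    have hyu : g y = u := le_antisymm (by simpa using hAc y hyD) (by simpa using hB' y hyC 0 le_rfl)
    refine ⟨-(α⁻¹ • g), mem_normalCone.2 ⟨hyC, fun c hc => ?_⟩, n + α⁻¹ • g,
      mem_normalCone.2 ⟨hyD, fun d hd => ?_⟩, by abel⟩
    · have h1 := hB' c hc 0 le_rfl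
      have h2 : 0 ≤ α⁻¹ * (g c - g y) := mul_nonneg (by positivity) (by linarith)
      simpa using h2
    · have h1 := hAc d hd
      have h2 : α⁻¹ * (g d - g y + n (d - y) * α) ≤ 0 :=
        mul_nonpos_of_nonneg_of_nonpos (by positivity) (by linarith)
      rw [mul_add, mul_comm _ α, inv_mul_cancel_left₀ hα0.ne'] at h2
      simp only [add_apply, smul_apply, smul_eq_mul]
      rw [map_sub g]
      linarith
  · rintro ⟨p, hp, q, hq, rfl⟩
    rw [mem_normalCone] at hp hq ⊢
    exact ⟨⟨hp.1, hq.1⟩, fun c hc => add_nonpos (hp.2 c hc.1) (hq.2 c hc.2)⟩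

theorem dom_add_normalCone (T : MultiOp X) (C : Set X) : dom (T + normalCone C) = dom T ∩ C := by
  ext x
  constructor
  · rintro ⟨_, t, ht, n, hn, -⟩
    exact ⟨⟨t, ht⟩, (mem_normalCone.1 hn).1⟩
  · rintro ⟨⟨t, ht⟩, hx⟩
    exact ⟨t + 0, t, ht, 0, mem_normalCone.2 ⟨hx, fun _ _ => by simp⟩, rfl⟩

/-! ### Localization and type (FPV) -/

theorem IsClassMaximal.mem_add_normalCone {S : MultiOp X} (hS : IsClassMaximal 0 S) {D : Set X}
    (hDc : IsClosed D) (hD : Convex ℝ D) (hne : (dom S ∩ interior D).Nonempty) {x : X} (hx : x ∈ D)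
    {x' : StrongDual ℝ X} (h : ∀ y ∈ D, ∀ y' ∈ S y, 0 ≤ (x' - y') (x - y)) :
    x' ∈ (S + normalCone D) x := by
  have hm : IsMaximalMonotone (S + normalCone D) := hS D ⟨hDc, hD, hne⟩
  refine hm.mem ?_
  rintro y _ ⟨s, hs, n, hn, rfl⟩
  obtain ⟨hy, hn⟩ := mem_normalCone.1 hn
  have h1 := h y hy s hs
  have h2 := hn x hx
  simp only [sub_apply, add_apply] at h1 ⊢
  linarith

theorem IsClassMaximal.isTypeFPV {S : MultiOp X} (hS : IsClassMaximal 0 S)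
    (hm : IsMaximalMonotone S) : IsTypeFPV S := by
  refine ⟨hm, ?_⟩
  rintro U hUo hU ⟨z, hzU, hz⟩ x hx x' h
  have hcomp : IsCompact (segment ℝ z x) := by
    rw [← convexHull_pair]
    exact (Set.toFinite {z, x}).isCompact_convexHull (𝕜 := ℝ)
  obtain ⟨δ, hδ, hδU⟩ := hcomp.exists_cthickening_subset_open hUo (hU.segment_subset hzU hx)
  have hint : segment ℝ z x ⊆ interior (Metric.cthickening δ (segment ℝ z x)) :=
    (Metric.self_subset_thickening hδ _).trans (Metric.thickening_subset_interior_cthickening _ _)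
  have hxD := hint (right_mem_segment ℝ z x)
  obtain ⟨s, hs, n, hn, hsn⟩ := hS.mem_add_normalCone Metric.isClosed_cthickening
    ((convex_segment z x).cthickening δ) ⟨z, hz, hint (left_mem_segment ℝ z x)⟩
    (interior_subset hxD) fun y hy => h y (hδU hy)
  rw [eq_zero_of_mem_normalCone hxD hn] at hsn
  simpa [← hsn] using hs

theorem convex_closure_of_add_smul_mem {A : Set X}
    (h : ∀ z ∈ A, ∀ c ∈ A, ∀ a b : ℝ, 0 < a → 0 < b → a + b = 1 → a • z + b • c ∈ closure A) :
    Convex ℝ (closure A) := by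
  rw [convex_iff_forall_pos]
  intro p hp q hq a b ha hb hab
  have hc : Continuous (Function.uncurry fun p q : X => a • p + b • q) := by
    simp only [Function.uncurry_def]
    fun_prop
  have := map_mem_closure₂ hc hp hq fun z hz c hc => h z hz c hc a b ha hb hab
  rwa [closure_closure] at this

theorem IsTypeFPV.convex_closure_dom {S : MultiOp X} (hS : IsTypeFPV S) :
    Convex ℝ (closure (dom S)) := by
  refine convex_closure_of_add_smul_mem ?_
  rintro z ⟨z', hz⟩ c ⟨c', hc⟩ a b ha hb hab
  by_contra hw
  set w := a • z + b • c with hwdef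
  obtain ⟨r, hr, hball⟩ := Metric.isOpen_iff.1 isClosed_closure.isOpen_compl w hw
  have hfar : ∀ y ∈ dom S, r ≤ ‖w - y‖ := fun y hy => by
    by_contra hlt
    refine hball (?_ : y ∈ Metric.ball w r) (subset_closure hy)
    rw [Metric.mem_ball, dist_comm, dist_eq_norm]
    exact not_le.1 hlt
  have hwz : ‖w - z‖ ≠ 0 := fun h => by
    have := hfar z ⟨z', hz⟩
    linarith
  obtain ⟨g, hg1, hg⟩ := exists_dual_vector ℝ (w - z) hwz
  simp only [RCLike.ofReal_real_eq_id, id_eq] at hg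
  set R := ‖w - z‖ + r with hR
  set K := ‖z'‖ * R + ‖c'‖ * (‖c - z‖ + R) with hK
  have hK0 : 0 ≤ K := by positivity
  have hU : Convex ℝ (Metric.thickening (r / 4) (segment ℝ z w)) := (convex_segment z w).thickening _
  -- Over the tube, monotonicity against `z'` and `c'` gives `y' (w - y) ≤ K`, while
  -- `g (w - y) ≥ r / 2` because the domain stays at distance `r` from the end `w`.
  have hrel : ∀ y ∈ Metric.thickening (r / 4) (segment ℝ z w), ∀ y' ∈ S y,
      0 ≤ ((2 * K / r) • g - y') (w - y) := by
    intro y hy y' hy'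
    obtain ⟨p, hp, hyp⟩ := Metric.mem_thickening_iff.1 hy
    obtain ⟨t, ⟨ht0, ht1⟩, rfl⟩ := (segment_eq_image' ℝ z w).subset hp
    rw [dist_eq_norm] at hyp
    set p := z + t • (w - z) with hpdef
    have hwp : w - p = (1 - t) • (w - z) := by rw [hpdef]; module
    have hgp : g (w - p) = ‖w - p‖ := by
      rw [hwp, map_smul, norm_smul, hg, Real.norm_of_nonneg (by linarith), smul_eq_mul]
    have hgy : -(r / 4) ≤ g (p - y) := by
      have h1 := g.le_opNorm (p - y)
      rw [hg1, one_mul, norm_sub_rev, Real.norm_eq_abs] at h1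
      linarith [neg_abs_le (g (p - y))]
    have hfar' := hfar y ⟨y', hy'⟩
    have htri : ‖w - y‖ ≤ ‖w - p‖ + ‖y - p‖ := by
      rw [norm_sub_rev y p]
      exact norm_sub_le_norm_sub_add_norm_sub w p y
    have hgw : r / 2 ≤ g (w - y) := by
      have : g (w - y) = g (w - p) + g (p - y) := by rw [← map_add]; congr 1; abel
      rw [this, hgp]
      linarith
    have hzy : ‖z - y‖ ≤ R := by
      have h1 : ‖z - y‖ ≤ ‖z - p‖ + ‖y - p‖ := by
        rw [norm_sub_rev y p]
        exact norm_sub_le_norm_sub_add_norm_sub z p y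
      have h2 : ‖z - p‖ ≤ ‖w - z‖ := by
        rw [show z - p = -(t • (w - z)) by rw [hpdef]; module, norm_neg, norm_smul,
          Real.norm_of_nonneg ht0]
        exact mul_le_of_le_one_left (norm_nonneg _) ht1
      linarith
    have hcy : ‖c - y‖ ≤ ‖c - z‖ + R :=
      (norm_sub_le_norm_sub_add_norm_sub c z y).trans (by linarith)
    have hmono : ∀ q, ∀ q' ∈ S q, ∀ ρ, ‖q - y‖ ≤ ρ → y' (q - y) ≤ ‖q'‖ * ρ := by
      intro q q' hq ρ hρ
      have h1 := hS.1.1 (q, q') hq (y, y') hy'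
      simp only [sub_apply] at h1
      have h2 := q'.le_opNorm (q - y)
      have h3 := mul_le_mul_of_nonneg_left hρ (norm_nonneg q')
      have h4 := le_abs_self (q' (q - y))
      rw [Real.norm_eq_abs] at h2
      linarith
    have hy1 := hmono z z' hz R hzy
    have hy2 := hmono c c' hc _ hcy
    have hsplit : y' (w - y) = a * y' (z - y) + b * y' (c - y) := by
      have : w - y = a • (z - y) + b • (c - y) := by
        rw [hwdef, smul_sub, smul_sub]
        have : y = a • y + b • y := by rw [← add_smul, hab, one_smul]
        nth_rewrite 1 [this]
        abel
      rw [this, map_add, map_smul, map_smul, smul_eq_mul, smul_eq_mul]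
    have hyK : y' (w - y) ≤ K := by
      have e1 : a * y' (z - y) ≤ ‖z'‖ * R :=
        (mul_le_mul_of_nonneg_left hy1 ha.le).trans
          (mul_le_of_le_one_left (by positivity) (by linarith))
      have e2 : b * y' (c - y) ≤ ‖c'‖ * (‖c - z‖ + R) :=
        (mul_le_mul_of_nonneg_left hy2 hb.le).trans
          (mul_le_of_le_one_left (by positivity) (by linarith))
      rw [hsplit]
      linarith
    have hkg : K ≤ 2 * K / r * g (w - y) := by
      calc K = 2 * K / r * (r / 2) := by field_simp
        _ ≤ _ := mul_le_mul_of_nonneg_left hgw (by positivity)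
    simp only [sub_apply, smul_apply, smul_eq_mul]
    linarith
  have hseg := Metric.self_subset_thickening (show 0 < r / 4 by linarith) (segment ℝ z w)
  have hmem := hS.2 _ Metric.isOpen_thickening hU
    ⟨z, hseg (left_mem_segment ℝ z w), z', hz⟩ w (hseg (right_mem_segment ℝ z w)) _ hrel
  exact hw (subset_closure ⟨_, hmem⟩)

/-! ### Regularity -/

theorem regularityGap_le_infEDist {S : MultiOp X} (hS : IsMonotone S) (x : X)
    (x' : StrongDual ℝ X) : regularityGap x x' S ≤ Metric.infEDist x' (S x) := by
  refine iSup₂_le fun p hp => Metric.le_infEDist.2 fun s hs => ?_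
  obtain ⟨hp, hpx⟩ := hp
  rw [edist_dist, dist_eq_norm]
  refine ENNReal.ofReal_le_ofReal ?_
  rw [div_le_iff₀ (norm_pos_iff.2 (sub_ne_zero.2 (Ne.symm hpx)))]
  have h1 := hS (x, s) hs p hp
  have h2 := (s - x').le_opNorm (x - p.1)
  have h3 := le_abs_self ((s - x') (x - p.1))
  rw [Real.norm_eq_abs, norm_sub_rev] at h2
  simp only [sub_apply] at h1 h2 h3 ⊢
  linarith

theorem apply_le_of_regularityGap_ne_top {S : MultiOp X} {x : X} {x' : StrongDual ℝ X}
    (hM : regularityGap x x' S ≠ ⊤) {y : X} {y' : StrongDual ℝ X} (hy : y' ∈ S y) :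
    (y' - x') (x - y) ≤ (regularityGap x x' S).toReal * ‖x - y‖ := by
  rcases eq_or_ne y x with rfl | hne
  · simp
  · rw [← div_le_iff₀ (norm_pos_iff.2 (sub_ne_zero.2 hne.symm))]
    refine (ENNReal.ofReal_le_iff_le_toReal hM).1 ?_
    exact le_iSup₂ (f := fun (p : X × StrongDual ℝ X) _ =>
      ENNReal.ofReal ((p.2 - x') (x - p.1) / ‖x - p.1‖)) (y, y') ⟨hy, hne⟩

theorem convexOn_mul_norm_sub_sub_apply {M : ℝ} (hM : 0 ≤ M) (f : StrongDual ℝ X) (x : X) :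
    ConvexOn ℝ Set.univ fun y => M * ‖y - x‖ - f (y - x) := by
  refine ConvexOn.sub ?_ ?_
  · have := (convexOn_univ_dist x).smul hM
    simpa only [dist_eq_norm, smul_eq_mul] using this
  · refine ⟨convex_univ, fun p _ q _ a b _ _ hab => ?_⟩
    have : f x = a * f x + b * f x := by rw [← add_mul, hab, one_mul]
    simp only [map_sub, map_add, map_smul, smul_eq_mul]
    linarith

/-- Localization to the Bishop–Phelps cone `{y | M‖y - x‖ ≤ f (y - x)}`: the pair `(x, x' - f)` is
monotonically related to `S` over this cone. -/
theorem IsClassMaximal.exists_mem_of_cone {S : MultiOp X} (hS : IsClassMaximal 0 S) {x : X}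
    {x' : StrongDual ℝ X} {M : ℝ} (hM : 0 ≤ M)
    (h : ∀ y, ∀ y' ∈ S y, (y' - x') (x - y) ≤ M * ‖x - y‖) (f : StrongDual ℝ X)
    (hz : ∃ z ∈ dom S, M * ‖z - x‖ < f (z - x)) :
    ∃ s ∈ S x, ∀ v, M * ‖v‖ ≤ f v → x' v - f v ≤ s v := by
  obtain ⟨z, hz, hzf⟩ := hz
  set D := {y | M * ‖y - x‖ - f (y - x) ≤ 0} with hDdef
  have hDc : IsClosed D := isClosed_le (by fun_prop) continuous_const
  have hD : Convex ℝ D := by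
    simpa only [Set.mem_univ, true_and] using (convexOn_mul_norm_sub_sub_apply hM f x).convex_le 0
  have hzD : z ∈ interior D := by
    have hopen : IsOpen {y | M * ‖y - x‖ - f (y - x) < 0} :=
      isOpen_lt (by fun_prop) continuous_const
    have hsub : {y | M * ‖y - x‖ - f (y - x) < 0} ⊆ D := fun y hy =>
      show M * ‖y - x‖ - f (y - x) ≤ 0 from le_of_lt hy
    exact interior_maximal hsub hopen (sub_neg.2 hzf)
  have hmem := hS.mem_add_normalCone hDc hD ⟨z, hz, hzD⟩ (x := x) (x' := x' - f) (by simp [hDdef])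
    fun y hy y' hy' => by
      have h1 := h y y' hy'
      have h2 : M * ‖y - x‖ - f (y - x) ≤ 0 := hy
      rw [norm_sub_rev] at h2
      simp only [sub_apply, map_sub] at h1 h2 ⊢
      linarith
  obtain ⟨s, hs, n, hn, hsn⟩ := hmem
  refine ⟨s, hs, fun v hv => ?_⟩
  have h1 := (mem_normalCone.1 hn).2 (x + v) (by simpa [hDdef] using hv)
  have h2 := congrArg (fun F : StrongDual ℝ X => F v) hsn
  simp only [sub_apply, add_apply, add_sub_cancel_left]
    at h1 h2
  linarith

theorem exists_separating_vector {A : Set (StrongDual ℝ X)} (hA : Convex ℝ A)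
    (hAc : IsClosed (WeakDual.toStrongDual ⁻¹' A : Set (WeakDual ℝ X))) {x' : StrongDual ℝ X}
    {M : ℝ} (hM : 0 ≤ M) (hdisj : Disjoint (Metric.closedBall x' M) A) :
    ∃ (v : X) (u : ℝ), (∀ s ∈ A, s v < u) ∧ u < x' v - M * ‖v‖ := by
  have : LocallyConvexSpace ℝ (WeakDual ℝ X) :=
    inferInstanceAs (LocallyConvexSpace ℝ (WeakBilin (topDualPairing ℝ X)))
  obtain ⟨F, u₁, u₂, hF1, hu, hF2⟩ := geometric_hahn_banach_closed_compact
    (hA.linear_preimage (WeakDual.toStrongDual (𝕜 := ℝ) (E := X)).toLinearMap) hAc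
    ((convex_closedBall x' M).linear_preimage
      (WeakDual.toStrongDual (𝕜 := ℝ) (E := X)).toLinearMap)
    (WeakDual.isCompact_closedBall x' M) (Disjoint.preimage _ hdisj.symm)
  obtain ⟨v, hv⟩ := LinearMap.dualEmbedding_surjective (topDualPairing ℝ X) F
  have hFv : ∀ p : StrongDual ℝ X, F (StrongDual.toWeakDual p) = p v := fun p => by
    rw [← hv]; rfl
  refine ⟨v, u₂, fun s hs => ?_, ?_⟩
  · have := hF1 (StrongDual.toWeakDual s) hs
    rw [hFv] at this
    exact this.trans hu
  · obtain ⟨g, hg1, hg⟩ : ∃ g : StrongDual ℝ X, ‖g‖ ≤ 1 ∧ g v = ‖v‖ := by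
      simpa using exists_dual_vector'' ℝ v
    have := hF2 (StrongDual.toWeakDual (x' - M • g)) (by
      change x' - M • g ∈ Metric.closedBall x' M
      rw [Metric.mem_closedBall, dist_eq_norm, sub_sub_cancel_left, norm_neg, norm_smul,
        Real.norm_of_nonneg hM]
      exact mul_le_of_le_one_right hM hg1)
    rw [hFv] at this
    simpa [hg] using this

theorem IsClassMaximal.nonempty_of_apply_le {S : MultiOp X} (hS : IsClassMaximal 0 S)
    (hm : IsMaximalMonotone S) {x : X} {x' : StrongDual ℝ X} {M : ℝ} (hM : 0 ≤ M)
    (h : ∀ y, ∀ y' ∈ S y, (y' - x') (x - y) ≤ M * ‖x - y‖) : (S x).Nonempty := by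
  obtain ⟨z, hz⟩ := hm.dom_nonempty
  rcases eq_or_ne z x with rfl | hne
  · exact hz
  have hpos : 0 < ‖z - x‖ := norm_pos_iff.2 (sub_ne_zero.2 hne)
  obtain ⟨g, -, hg⟩ := exists_dual_vector ℝ (z - x) hpos.ne'
  obtain ⟨s, hs, -⟩ := hS.exists_mem_of_cone hM h ((M + 1) • g) ⟨z, hz, by simp [hg]; linarith⟩
  exact ⟨s, hs⟩

theorem IsClassMaximal.exists_mem_closedBall {S : MultiOp X} (hS : IsClassMaximal 0 S)
    (hm : IsMaximalMonotone S) {x : X} {x' : StrongDual ℝ X} {M : ℝ} (hM : 0 ≤ M)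
    (h : ∀ y, ∀ y' ∈ S y, (y' - x') (x - y) ≤ M * ‖x - y‖) :
    ∃ s ∈ S x, s ∈ Metric.closedBall x' M := by
  by_contra hcon
  have hdisj : Disjoint (Metric.closedBall x' M) (S x) :=
    Set.disjoint_left.2 fun s hsb hs => hcon ⟨s, hs, hsb⟩
  obtain ⟨v, u, hvS, hvu⟩ :=
    exists_separating_vector (hm.convex_apply x) (hm.isClosed_weakDual x) hM hdisj
  obtain ⟨s₀, hs₀⟩ := hS.nonempty_of_apply_le hm hM h
  have hv : v ≠ 0 := by
    rintro rfl
    have := hvS s₀ hs₀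
    simp only [map_zero, norm_zero, mul_zero, sub_zero] at this hvu
    linarith
  have hvpos : 0 < ‖v‖ := norm_pos_iff.2 hv
  obtain ⟨g, -, hg⟩ := exists_dual_vector ℝ v hvpos.ne'
  simp only [RCLike.ofReal_real_eq_id, id_eq] at hg
  -- The slope `M'` exceeds `M`, so that `v` is interior to the cone, but respects the gap at `v`.
  obtain ⟨M', hM', hgap⟩ : ∃ M', M < M' ∧ M' * ‖v‖ = x' v - u := by
    refine ⟨(x' v - u) / ‖v‖, ?_, div_mul_cancel₀ _ hvpos.ne'⟩
    rw [lt_div_iff₀ hvpos]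
    linarith
  have hfv : (M' • g) v = x' v - u := by simp [hg, hgap]
  by_cases hz : ∃ z ∈ dom S, M * ‖z - x‖ < (M' • g) (z - x)
  · obtain ⟨s, hs, hsv⟩ := hS.exists_mem_of_cone hM h (M' • g) hz
    have h1 := hsv v (by rw [hfv]; linarith)
    have h2 := hvS s hs
    linarith
  · set K := {y | M * ‖y - x‖ - (M' • g) (y - x) < 0} with hK
    have hKo : IsOpen K := isOpen_lt (by fun_prop) continuous_const
    have hKc : Convex ℝ K := by
      simpa only [Set.mem_univ, true_and] using
        (convexOn_mul_norm_sub_sub_apply hM (M' • g) x).convex_lt 0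
    have hKd : Disjoint K (closure (dom S)) := by
      refine Disjoint.closure_right (Set.disjoint_left.2 fun y hy hyd => hz ⟨y, hyd, ?_⟩) hKo
      exact sub_neg.1 hy
    obtain ⟨n, c, hn1, hn2⟩ := geometric_hahn_banach_open hKc hKo
      (hS.isTypeFPV hm).convex_closure_dom hKd
    have hray : ∀ t : ℝ, 0 < t → n x + t * n v < c := fun t ht => by
      have := hn1 (x + t • v) (by
        simp only [hK, Set.mem_ofPred_eq, add_sub_cancel_left, norm_smul, map_smul, smul_eq_mul,
          Real.norm_of_nonneg ht.le, hfv]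
        have : t * (M * ‖v‖) < t * (x' v - u) := mul_lt_mul_of_pos_left (by linarith) ht
        linarith)
      simpa using this
    have hcx : c ≤ n x := hn2 x (subset_closure ⟨s₀, hs₀⟩)
    have hnv : n v < 0 := by
      have := hray 1 one_pos
      linarith
    have hxc : n x ≤ c := by
      by_contra hlt
      have := hray ((n x - c) / (-n v)) (div_pos (by linarith) (by linarith))
      rw [div_neg, neg_mul, div_mul_cancel₀ _ hnv.ne] at this
      linarith
    -- `-n` is normal to `dom S` at `x`, hence a direction of recession of `S x`.
    have hrec : ∀ t : ℝ, 0 ≤ t → s₀ - t • n ∈ S x := fun t ht => by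
      rw [hm.mem_iff]
      intro y y' hy
      have h1 := hm.mem_iff.1 hs₀ y y' hy
      have h2 := hn2 y (subset_closure ⟨y', hy⟩)
      have h3 : t * n (x - y) ≤ 0 :=
        mul_nonpos_of_nonneg_of_nonpos ht (by rw [map_sub]; linarith)
      simp only [sub_apply, smul_apply, smul_eq_mul]
      linarith
    have hlt := hvS s₀ hs₀
    have := hvS _ (hrec ((u - s₀ v) / (-n v)) (div_nonneg (by linarith) (by linarith)))
    simp only [sub_apply, smul_apply, smul_eq_mul] at this
    rw [div_neg, neg_mul, div_mul_cancel₀ _ hnv.ne] at this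
    linarith

theorem IsClassMaximal.isRegular {S : MultiOp X} (hS : IsClassMaximal 0 S)
    (hm : IsMaximalMonotone S) : IsRegular S := by
  refine ⟨hm, fun x x' => le_antisymm (regularityGap_le_infEDist hm.1 x x') ?_⟩
  rcases eq_or_ne (regularityGap x x' S) ⊤ with htop | htop
  · exact htop ▸ le_top
  obtain ⟨s, hs, hsb⟩ := hS.exists_mem_closedBall hm (x := x) (x' := x')
    (M := (regularityGap x x' S).toReal)
    ENNReal.toReal_nonneg fun y y' hy => apply_le_of_regularityGap_ne_top htop hy
  refine (Metric.infEDist_le_edist_of_mem hs).trans ?_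
  rw [edist_dist, dist_comm]
  exact ENNReal.ofReal_le_of_le_toReal hsb

/-! ### The classes `𝒞₀` and `𝒞₁` -/

theorem IsClassMaximal.inter_mem_class0 {T : MultiOp X} (hT : IsClassMaximal 0 T) {C D : Set X}
    (hC : C ∈ class0 T) (hDc : IsClosed D) (hD : Convex ℝ D)
    (hne : (dom T ∩ C ∩ interior D).Nonempty) : C ∩ D ∈ class0 T := by
  obtain ⟨hCc, hCv, c, hcT, hcC⟩ := hC
  obtain ⟨z, ⟨hzT, hzC⟩, hzD⟩ := hne
  have hm : IsMaximalMonotone T := by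
    have := hT Set.univ ⟨isClosed_univ, convex_univ, z, hzT, by simp⟩
    rwa [show subdifferential (indicatorFun (Set.univ : Set X)) = 0 from normalCone_univ,
      add_zero] at this
  obtain ⟨t, ht0, ht1, ht⟩ := exists_pos_add_smul_mem hzD (c - z)
  have hcl : z + t • (c - z) ∈ closure (dom T) :=
    (hT.isTypeFPV hm).convex_closure_dom.add_smul_sub_mem (subset_closure hzT) (subset_closure hcT)
      ⟨ht0.le, ht1.le⟩
  have hint : z + t • (c - z) ∈ interior C :=
    hCv.add_smul_sub_mem_interior' (subset_closure hzC) hcC ⟨ht0, ht1.le⟩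
  obtain ⟨y, ⟨hyC, hyD⟩, hyT⟩ := mem_closure_iff.1 hcl (interior C ∩ interior D)
    (isOpen_interior.inter isOpen_interior) ⟨hint, ht⟩
  exact ⟨hCc.inter hDc, hCv.inter hD, y, hyT, by rw [interior_inter]; exact ⟨hyC, hyD⟩⟩

theorem inter_mem_class1 {T : MultiOp X} {C D : Set X} (hC : C ∈ class1 T) (hDc : IsClosed D)
    (hD : Convex ℝ D) (hne : (dom T ∩ C ∩ interior D).Nonempty) : C ∩ D ∈ class1 T := by
  obtain ⟨hCc, hCv, Y, hYc, hY⟩ := hC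
  obtain ⟨z, ⟨hzT, hzC⟩, hzD⟩ := hne
  refine ⟨hCc.inter hDc, hCv.inter hD, Y, hYc, ?_⟩
  rw [← hY]
  refine Set.Subset.antisymm (Set.iUnion₂_mono fun r _ => Set.smul_set_mono
    (Set.sub_subset_sub_left Set.inter_subset_left)) (Set.iUnion₂_subset fun r hr => ?_)
  rintro _ ⟨_, ⟨a, ha, c, hc, rfl⟩, rfl⟩
  obtain ⟨t, ht0, ht1, ht⟩ := exists_pos_add_smul_mem hzD (c - z)
  refine Set.mem_iUnion₂.2 ⟨r / t, div_pos hr ht0, _, ⟨z + t • (a - z), ?_, z + t • (c - z), ?_,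
    rfl⟩, ?_⟩
  · exact (convex_convexHull ℝ _).add_smul_sub_mem (subset_convexHull ℝ _ hzT) ha
      ⟨ht0.le, ht1.le⟩
  · exact ⟨hCv.add_smul_sub_mem hzC hc ⟨ht0.le, ht1.le⟩, interior_subset ht⟩
  · have : z + t • (a - z) - (z + t • (c - z)) = t • (a - c) := by module
    simp only [this, smul_smul, div_mul_cancel₀ _ ht0.ne']

/-- The sum of a `𝒞ᵢ`-maximal operator and the normal cone operator of a set of the class `𝒞ᵢ` is
`𝒞₀`-maximal. -/
theorem IsClassMaximal.add_normalCone {T : MultiOp X} {i : Fin 2} (hT : IsClassMaximal i T)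
    {C : Set X} (hC : C ∈ constraintClass T i) : IsClassMaximal 0 (T + normalCone C) := by
  rintro D ⟨hDc, hD, hne⟩
  rw [dom_add_normalCone] at hne
  have hCv : Convex ℝ C ∧ C ∩ D ∈ constraintClass T i := by
    fin_cases i
    · exact ⟨hC.2.1, hT.inter_mem_class0 hC hDc hD hne⟩
    · exact ⟨hC.2.1, inter_mem_class1 hC hDc hD hne⟩
  have hsum := normalCone_inter hCv.1 hD (hne.mono fun _ hy => ⟨hy.1.2, hy.2⟩)
  have := hT _ hCv.2
  rwa [show subdifferential (indicatorFun (C ∩ D)) = _ from hsum, ← add_assoc] at this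

end MultiOp

theorem theorem2p11 {X : Type*} [NormedAddCommGroup X] [NormedSpace ℝ X] [CompleteSpace X]
    [Nontrivial X] (T : MultiOp X) (hT : MultiOp.IsMonotone T) (i : Fin 2)
    (hmax : MultiOp.IsClassMaximal i T) :
    (∀ C ∈ MultiOp.constraintClass T i,
      MultiOp.IsTypeFPV (T + MultiOp.subdifferential (MultiOp.indicatorFun C)) ∧
      MultiOp.IsRegular (T + MultiOp.subdifferential (MultiOp.indicatorFun C))) ∧
    MultiOp.IsClassRegular i T := by
  have key := fun C hC => (hmax.add_normalCone (C := C) hC)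
  exact ⟨fun C hC => ⟨(key C hC).isTypeFPV (hmax C hC), (key C hC).isRegular (hmax C hC)⟩,
    fun C hC => (key C hC).isRegular (hmax C hC)⟩
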